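/- Let $(\Omega,\mathcal F)$ be a measurable space, $X_1,X_2,\dots$ real random variables on it, $\mathcal F_n=\sigma(X_1,\dots,X_n)$, and $\mathcal P$ a set of probability measures on $(\Omega,\mathcal F)$ under each of which $(X_n)$ is iid. Let $\mu\in\mathbb R$ and $\delta>0$, and suppose that $\mathbb E_P[X_1]=\mu$ and $\mathbb E_P|X_1-\mu|^{2+\delta}<\infty$ for every $P\in\mathcal P$, and that $\sup_{P\in\mathcal P}\mathbb E_P|X_1|^{2+\delta}<\infty$. Write $\overline X_k=k^{-1}\sum_{i\le k}X_i$, $\hat s_k^2=k^{-1}\sum_{i\le k}(X_i-\overline X_k)^2$ and $\hat u_k^{(m)}=k(\hat s_k^2+1/\log m)$ for $k\ge m$. Fix $C,\rho>0$. Then the intervals $$\mathcal H_k^{(m)}(\alpha)=\left(\overline X_k\pm\sqrt{\frac{2\rho\hat u_k^{(m)}+2}{k^2\rho}\,\log\left(\frac{\sqrt{\rho\hat u_k^{(m)}+1}}{\alpha}\right)}\right)\qquad(k\ge m)$$ (open intervals, read as empty when the logarithm is negative) form a $\mathcal P$-uniform asymptotic post-hoc confidence sequence for $\mu$ with range growth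 function $f(m)=C\,m^{-0.24}$. That is, $f$ is positive and nonincreasing on $m\ge1$, less than $1$ for all large $m$, and for every stopping time $\tau$ with respect to $(\mathcal F_n)$, $$\limsup_{m\to\infty}\ \sup_{P\in\mathcal P}\ \mathbb E_P\left[\sup_{\alpha>f(m)}\frac{\mathbf 1\{\mu\notin\mathcal H_{\tau\vee m}^{(m)}(\alpha)\}}{\alpha}\right]\le 1,$$ where, if $\tau$ may be infinite, the integrand is taken to be $0$ on $\{\tau=\infty\}$. -/

import Mathlib

open MeasureTheory ProbabilityTheory Filter
open scoped ENNReal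

/-- The observations are `X 0, X 1, …`, where `X i` is the `(i + 1)`-st observation, so the first `n`
observations are the `X i` with `i < n`. This is the filtration
`ℱ n = σ(first n observations)`, with `ℱ 0` trivial. -/
def observationFiltration {Ω : Type*} [mΩ : MeasurableSpace Ω] (X : ℕ → Ω → ℝ)
    (hX : ∀ i, Measurable (X i)) : Filtration ℕ mΩ where
  seq n := ⨆ i, ⨆ _ : i < n, MeasurableSpace.comap (X i) inferInstance
  mono' _ _ hmn := iSup_mono fun _ => iSup_le fun hi =>
    le_iSup_of_le (lt_of_lt_of_le hi hmn) le_rfl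
  le' _ := iSup_le fun i => iSup_le fun _ => (hX i).comap_le

/-- The set of distributions on the real line that have mean `θ` and a finite central absolute
`q`-th moment. -/
def momentClass (q θ : ℝ) : Set (Measure ℝ) :=
  {ν | IsProbabilityMeasure ν ∧ Integrable (fun x : ℝ => x) ν ∧ ∫ x, x ∂ν = θ ∧
    ∫⁻ x, ENNReal.ofReal (|x - θ| ^ q) ∂ν < ∞}

/-- The random variable `Y` has a `𝒬`-uniformly bounded `q`-th moment:
`sup_{P ∈ 𝒬} E_P |Y| ^ q < ∞`. -/
def UniformlyBoundedMoment {Ω : Type*} [MeasurableSpace Ω] (𝒬 : Set (ProbabilityMeasure Ω))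
    (Y : Ω → ℝ) (q : ℝ) : Prop :=
  (⨆ P ∈ 𝒬, ∫⁻ ω, ENNReal.ofReal (|Y ω| ^ q) ∂(P : Measure Ω)) < ∞

/-- `sup_{α > a} 1{ϑ ∉ K α} / α`, the post-hoc loss of the family of sets `K` for the true value
`ϑ`, over levels larger than `a`. -/
noncomputable def postHocLoss (K : ℝ → Set ℝ) (a ϑ : ℝ) : ℝ≥0∞ :=
  ⨆ α : ℝ, ⨆ _ : a < α, (K α)ᶜ.indicator (fun _ => (1 : ℝ≥0∞)) ϑ / ENNReal.ofReal α

/-- The array `H m k α ω` (`k ≥ m`; the entries with `k < m` are never looked at) is a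
`𝒬`-uniform asymptotic post-hoc confidence sequence for the parameters `θ P`, with range growth
function `f`, relative to the filtration `ℱ`.

The function `f` lives on the indices `m ≥ 1`, where it is positive and nonincreasing, and it takes
values in `(0, 1)` for all large `m`.

Stopping times may take the value `⊤`; on this event sampling never stops, there is no reported set,
and no loss is incurred. -/
structure IsAsympPostHocConfSeq {Ω : Type*} [mΩ : MeasurableSpace Ω] (ℱ : Filtration ℕ mΩ)
    (𝒬 : Set (ProbabilityMeasure Ω)) (θ : ProbabilityMeasure Ω → ℝ)
    (H : ℕ → ℕ → ℝ → Ω → Set ℝ) (f : ℕ → ℝ) : Prop where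
  antitone : AntitoneOn f (Set.Ici 1)
  pos : ∀ m, 1 ≤ m → 0 < f m
  eventually_lt_one : ∀ᶠ m in atTop, f m < 1
  risk_le : ∀ τ : Ω → WithTop ℕ, IsStoppingTime ℱ τ →
    limsup (fun m : ℕ => ⨆ P ∈ 𝒬, ∫⁻ ω,
      {ω | τ ω ≠ ⊤}.indicator
        (fun ω => postHocLoss (fun α => H m (max ((τ ω).untopD 0) m) α ω) (f m) (θ P)) ω
        ∂(P : Measure Ω)) atTop ≤ 1

/-- The mean of the first `k` observations. -/
noncomputable def sampleMean {Ω : Type*} (X : ℕ → Ω → ℝ) (k : ℕ) (ω : Ω) : ℝ :=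
  (∑ i ∈ Finset.range k, X i ω) / k

/-- The (biased) sample variance of the first `k` observations. -/
noncomputable def sampleVar {Ω : Type*} (X : ℕ → Ω → ℝ) (k : ℕ) (ω : Ω) : ℝ :=
  (∑ i ∈ Finset.range k, (X i ω - sampleMean X k ω) ^ 2) / k

/-- `û_k^{(m)} = k (ŝ_k² + 1 / log m)`. -/
noncomputable def uHat {Ω : Type*} (X : ℕ → Ω → ℝ) (m k : ℕ) (ω : Ω) : ℝ :=
  k * (sampleVar X k ω + 1 / Real.log m)

/-- The half-width of the mixture interval. For `α > √(ρ û + 1)`, which is larger than one, the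
logarithm is negative, the square root is zero, and the open interval below is empty. -/
noncomputable def mixtureHalfWidth {Ω : Type*} (X : ℕ → Ω → ℝ) (ρ : ℝ) (m k : ℕ) (α : ℝ)
    (ω : Ω) : ℝ :=
  Real.sqrt ((2 * ρ * uHat X m k ω + 2) / ((k : ℝ) ^ 2 * ρ) *
    Real.log (Real.sqrt (ρ * uHat X m k ω + 1) / α))

/-- The open mixture interval, centred at the sample mean. -/
noncomputable def mixtureInterval {Ω : Type*} (X : ℕ → Ω → ℝ) (ρ : ℝ) (m k : ℕ) (α : ℝ)
    (ω : Ω) : Set ℝ :=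
  Set.Ioo (sampleMean X k ω - mixtureHalfWidth X ρ m k α ω)
    (sampleMean X k ω + mixtureHalfWidth X ρ m k α ω)

/-!
The proof needs no Gaussian approximation: up to an event of small probability, the intervals invert
a nonnegative supermartingale that is valid for every finite sample size.

Write `Y i = X i - μ`, `S k` for the sum of the first `k` of them, and `σ²` for their variance. The
level `α` is rejected at `k` only if `1 / α` is at most the Gaussian mixture
`∫ exp (l * S k - l ^ 2 * û / 2) dN(0, ρ)(l)`, which has a closed form (`ofReal_gaussianMixture`) and
decreases in `û`. The inequality `exp (x - x ^ 2 / 6) ≤ 1 + x + x ^ 2 / 3` shows that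
`exp (l * S k - l ^ 2 * V k / 2)`, with the variance proxy `V k = ∑ i < k, (Y i ^ 2 / 3 + 2 * σ² / 3)`,
is a supermartingale for every `l` as soon as the second moment is finite. Hence the mixture with
`V` in place of `û` has expectation at most one at every stopping time
(`tsum_setLIntegral_gaussianMixture_le_one`).

It remains to compare `û` with `V`. Since `û = ∑ i < k, Y i ^ 2 - S k ^ 2 / k + k / log m`, the term
`k / log m` pays for the comparison (`variance_proxy_le_uHat`) if, for all `k ≥ m`, the running mean
of `Y` is of order at most `(log m) ^ (-1 / 2)` and the running mean of `min (Y ^ 2) b` is within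
order `1 / log m` of its expectation, where `b = m ^ (1 / 8)`; the moment of order `2 + δ` makes the
truncation bias `O(m ^ (-δ / 16))`, uniformly over the class. Both conditions fail with probability
`O(m ^ (-3 / 4) * (log m) ^ 2)` by the Hájek–Rényi inequality (`measure_exists_mul_le_abs_sum_le`). On
that exceptional event the loss is at most `1 / f m`, of order `m ^ 0.24`, so that its contribution
vanishes in the limit.
-/

/-! ### Optional stopping and a maximal inequality -/

/-- Optional stopping for a nonnegative supermartingale `A`, given by its set-wise inequalities:
stopping at `k` on `E k`, and never outside `⋃ k, E k`, does not increase the expectation. -/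
lemma tsum_setLIntegral_le_lintegral_zero {Ω : Type*} {mΩ : MeasurableSpace Ω} {P : Measure Ω}
    {ℱ : ℕ → MeasurableSpace Ω} (hmono : Monotone ℱ) (hle : ∀ k, ℱ k ≤ mΩ)
    {A : ℕ → Ω → ℝ≥0∞}
    (hA : ∀ k F, MeasurableSet[ℱ k] F → ∫⁻ ω in F, A (k + 1) ω ∂P ≤ ∫⁻ ω in F, A k ω ∂P)
    {E : ℕ → Set Ω} (hE : ∀ k, MeasurableSet[ℱ k] (E k))
    (hdisj : Pairwise (Function.onFun Disjoint E)) :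
    ∑' k, ∫⁻ ω in E k, A k ω ∂P ≤ ∫⁻ ω, A 0 ω ∂P := by
  have hR : ∀ n, MeasurableSet[ℱ n] (⋃ k ∈ Finset.range (n + 1), E k)ᶜ := fun n =>
    MeasurableSet.compl (Finset.measurableSet_biUnion _ fun k hk =>
      hmono (Nat.lt_succ_iff.1 (Finset.mem_range.1 hk)) _ (hE k))
  have hsplit : ∀ n, ∫⁻ ω in (⋃ k ∈ Finset.range n, E k)ᶜ, A n ω ∂P
      = ∫⁻ ω in E n, A n ω ∂P
        + ∫⁻ ω in (⋃ k ∈ Finset.range (n + 1), E k)ᶜ, A n ω ∂P := by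
    intro n
    rw [← lintegral_union (hle n _ (hR n))]
    · congr 2
      ext ω
      simp only [Finset.mem_range, Set.mem_compl_iff, Set.mem_iUnion, exists_prop, not_exists,
        not_and, Set.mem_union]
      constructor
      · intro h
        by_cases hn : ω ∈ E n
        · exact Or.inl hn
        · refine Or.inr fun k hk => ?_
          rcases Nat.lt_succ_iff_lt_or_eq.1 hk with hk | rfl
          · exact h k hk
          · exact hn
      · rintro (h | h) k hk
        · exact fun hk' => (hdisj hk.ne).ne_of_mem hk' h rfl
        · exact h k (hk.trans n.lt_succ_self)
    · refine Set.disjoint_left.2 fun ω h1 h2 => h2 ?_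
      exact Set.mem_biUnion (Finset.mem_coe.2 (Finset.self_mem_range_succ n)) h1
  have hind : ∀ n, ∑ k ∈ Finset.range n, ∫⁻ ω in E k, A k ω ∂P
      + ∫⁻ ω in (⋃ k ∈ Finset.range n, E k)ᶜ, A n ω ∂P ≤ ∫⁻ ω, A 0 ω ∂P := by
    intro n
    induction n with
    | zero => simp
    | succ n ih =>
      refine le_trans ?_ ih
      rw [Finset.sum_range_succ, hsplit n, add_assoc]
      exact add_le_add_right (add_le_add_right (hA n _ (hR n)) _) _
  rw [ENNReal.tsum_eq_iSup_nat]
  exact iSup_le fun n => le_self_add.trans (hind n)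

/-- Ville's maximal inequality. -/
lemma mul_measure_iUnion_le_lintegral_zero {Ω : Type*} {mΩ : MeasurableSpace Ω} {P : Measure Ω}
    {ℱ : ℕ → MeasurableSpace Ω} (hmono : Monotone ℱ) (hle : ∀ k, ℱ k ≤ mΩ)
    {A : ℕ → Ω → ℝ≥0∞} (hmeas : ∀ k, Measurable[ℱ k] (A k))
    (hA : ∀ k F, MeasurableSet[ℱ k] F → ∫⁻ ω in F, A (k + 1) ω ∂P ≤ ∫⁻ ω in F, A k ω ∂P)
    (c : ℝ≥0∞) :
    c * P (⋃ k, {ω | c ≤ A k ω}) ≤ ∫⁻ ω, A 0 ω ∂P := by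
  have hB : ∀ k, MeasurableSet[ℱ k] {ω | c ≤ A k ω} := fun k => hmeas k measurableSet_Ici
  have hE : ∀ k, MeasurableSet[ℱ k] (disjointed (fun k => {ω | c ≤ A k ω}) k) := by
    intro k
    rw [disjointed_eq_inter_compl]
    exact (hB k).inter (MeasurableSet.iInter fun j => MeasurableSet.iInter fun hj =>
      (hmono hj.le _ (hB j)).compl)
  rw [← iUnion_disjointed, measure_iUnion (disjoint_disjointed _) fun k => hle k _ (hE k),
    ← ENNReal.tsum_mul_left]
  refine le_trans (ENNReal.tsum_le_tsum fun k => ?_)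
    (tsum_setLIntegral_le_lintegral_zero hmono hle hA hE (disjoint_disjointed _))
  rw [← setLIntegral_const]
  exact setLIntegral_mono' (hle k _ (hE k)) fun ω hω => disjointed_subset _ k hω

/-- The Hájek–Rényi inequality for the running means of centred independent variables whose second
moments are at most `v`. The process `S k ^ 2 / k ^ 2 + v / k` is a supermartingale, because
`1 / (k + 1) ^ 2 + 1 / (k + 1) ≤ 1 / k`. -/
lemma measure_exists_mul_le_abs_sum_le {Ω : Type*} {mΩ : MeasurableSpace Ω} {P : Measure Ω}
    [IsProbabilityMeasure P] (ℱ : Filtration ℕ mΩ) {Z : ℕ → Ω → ℝ} {v : ℝ}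
    (hmeas : ∀ i, Measurable[ℱ (i + 1)] (Z i))
    (hind : ∀ i, Indep (ℱ i) (MeasurableSpace.comap (Z i) inferInstance) P)
    (hL2 : ∀ i, MemLp (Z i) 2 P) (hmean : ∀ i, ∫ ω, Z i ω ∂P = 0)
    (hvar : ∀ i, ∫ ω, Z i ω ^ 2 ∂P ≤ v) {m : ℕ} (hm : 1 ≤ m) {ε : ℝ} (hε : 0 < ε) :
    P (⋃ k, {ω | ((m + k : ℕ) : ℝ) * ε ≤ |∑ i ∈ Finset.range (m + k), Z i ω|})
      ≤ ENNReal.ofReal (2 * v / (m * ε ^ 2)) := by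
  have hv : 0 ≤ v := (integral_nonneg fun ω => sq_nonneg _).trans (hvar 0)
  set S : ℕ → Ω → ℝ := fun k ω => ∑ i ∈ Finset.range k, Z i ω with hS
  have hSmeas : ∀ k, Measurable[ℱ k] (S k) := fun k =>
    Finset.measurable_sum _ fun i hi => (hmeas i).mono (ℱ.mono (Finset.mem_range.1 hi)) le_rfl
  have hSL2 : ∀ k, MemLp (S k) 2 P := fun k => memLp_finsetSum _ fun i _ => hL2 i
  have hS2 : ∀ k, Integrable (fun ω => S k ω ^ 2) P := fun k => (hSL2 k).integrable_sq
  have hZ2 : ∀ k, Integrable (fun ω => Z k ω ^ 2) P := fun k => (hL2 k).integrable_sq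
  have hSZ : ∀ k, Integrable (fun ω => S k ω * Z k ω) P := fun k =>
    (hSL2 k).integrable_mul (hL2 k)
  have hstep : ∀ k F, MeasurableSet[ℱ k] F →
      ∫ ω in F, S (k + 1) ω ^ 2 ∂P ≤ ∫ ω in F, S k ω ^ 2 ∂P + P.real F * v := by
    intro k F hF
    have hF' := ℱ.le k _ hF
    have hcross : ∫ ω in F, S k ω * Z k ω ∂P = 0 := by
      have hi : IndepFun (F.indicator (S k)) (Z k) P := by
        refine indep_of_indep_of_le_left (hind k) ?_
        exact ((hSmeas k).indicator hF).comap_le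
      have := hi.integral_mul_eq_mul_integral
        (((hSL2 k).1).indicator hF') (hL2 k).1
      rw [hmean k, mul_zero] at this
      rw [← integral_indicator hF', ← this]
      refine integral_congr_ae (Eventually.of_forall fun ω => ?_)
      by_cases h : ω ∈ F <;> simp [h]
    have hsq : ∫ ω in F, Z k ω ^ 2 ∂P ≤ P.real F * v := by
      have hi : IndepFun (F.indicator (fun _ => (1 : ℝ))) (fun ω => Z k ω ^ 2) P := by
        refine indep_of_indep_of_le_left (indep_of_indep_of_le_right (hind k) ?_) ?_
        · exact ((comap_measurable (Z k)).pow_const 2).comap_le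
        · exact (measurable_const.indicator hF).comap_le
      have := hi.integral_mul_eq_mul_integral
        ((measurable_const.indicator hF').aestronglyMeasurable) (hZ2 k).1
      rw [integral_indicator_const _ hF', smul_eq_mul, mul_one] at this
      rw [← integral_indicator hF']
      calc _ = _ := ?_
        _ = _ := this
        _ ≤ _ := by gcongr; exact hvar k
      refine integral_congr_ae (Eventually.of_forall fun ω => ?_)
      by_cases h : ω ∈ F <;> simp [h]
    have : ∫ ω in F, S (k + 1) ω ^ 2 ∂P = ∫ ω in F, S k ω ^ 2 ∂P
        + 2 * ∫ ω in F, S k ω * Z k ω ∂P + ∫ ω in F, Z k ω ^ 2 ∂P := by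
      have h1 : Integrable (fun ω => S k ω ^ 2 + 2 * (S k ω * Z k ω)) P :=
        (hS2 k).add ((hSZ k).const_mul 2)
      rw [← integral_const_mul, ← integral_add (hS2 k).restrict ((hSZ k).const_mul 2).restrict,
        ← integral_add h1.restrict (hZ2 k).restrict]
      refine integral_congr_ae (Eventually.of_forall fun ω => ?_)
      simp only [hS, Finset.sum_range_succ]
      ring
    rw [this, hcross]
    linarith
  have hSm : ∫ ω, S m ω ^ 2 ∂P ≤ m * v := by
    have : ∀ k : ℕ, ∫ ω, S k ω ^ 2 ∂P ≤ k * v := by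
      intro k
      induction k with
      | zero => simp [hS]
      | succ k ih =>
        have := hstep k Set.univ MeasurableSet.univ
        simp only [Measure.restrict_univ, probReal_univ, one_mul] at this
        push_cast
        linarith
    exact this m
  set A : ℕ → Ω → ℝ := fun k ω => S (m + k) ω ^ 2 / ((m + k : ℕ) : ℝ) ^ 2 + v / ((m + k : ℕ) : ℝ)
    with hA
  have hA0 : ∀ k ω, 0 ≤ A k ω := fun k ω => by positivity
  have hAint : ∀ k, Integrable (A k) P := fun k =>
    ((hS2 _).div_const _).add (integrable_const _)
  have hAF : ∀ k F, MeasurableSet F → ∫ ω in F, A k ω ∂P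
      = (∫ ω in F, S (m + k) ω ^ 2 ∂P) / ((m + k : ℕ) : ℝ) ^ 2
        + P.real F * (v / ((m + k : ℕ) : ℝ)) := by
    intro k F hF
    rw [integral_add ((hS2 _).div_const _).restrict (integrable_const _), integral_div]
    simp
  have hville := mul_measure_iUnion_le_lintegral_zero (P := P) (ℱ := fun k => ℱ (m + k))
    (A := fun k ω => ENNReal.ofReal (A k ω)) (fun i j h => ℱ.mono (by omega))
    (fun k => ℱ.le _)
    (fun k => (((hSmeas (m + k)).pow_const 2).div_const _ |>.add_const _).ennreal_ofReal) ?_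
    (ENNReal.ofReal (ε ^ 2))
  · have hpos : (0 : ℝ) < m := by exact_mod_cast hm
    have hbd : ∫⁻ ω, ENNReal.ofReal (A 0 ω) ∂P ≤ ENNReal.ofReal (2 * v / m) := by
      rw [← ofReal_integral_eq_lintegral_ofReal (hAint 0) (Eventually.of_forall (hA0 0))]
      refine ENNReal.ofReal_le_ofReal ?_
      have := hAF 0 Set.univ MeasurableSet.univ
      simp only [Measure.restrict_univ, probReal_univ, one_mul, add_zero] at this
      rw [this]
      calc _ ≤ (m * v) / (m : ℝ) ^ 2 + v / m := by gcongr
        _ = _ := by field_simp; ring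
    have h2 : P (⋃ k, {ω | ENNReal.ofReal (ε ^ 2) ≤ ENNReal.ofReal (A k ω)})
        ≤ ENNReal.ofReal (2 * v / (m * ε ^ 2)) := by
      have hε2 : 0 < ε ^ 2 := by positivity
      have h3 := (ENNReal.le_div_iff_mul_le (Or.inl (by simpa using hε.ne'))
        (Or.inl ENNReal.ofReal_ne_top)).2 ((mul_comm _ _).trans_le (hville.trans hbd))
      rw [← ENNReal.ofReal_div_of_pos hε2] at h3
      refine h3.trans_eq ?_
      rw [div_div]
    refine le_trans (measure_mono (Set.iUnion_mono fun k ω hω => ?_)) h2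
    refine ENNReal.ofReal_le_ofReal ?_
    have hk : (0 : ℝ) < ((m + k : ℕ) : ℝ) := by exact_mod_cast (by omega)
    have h4 : (((m + k : ℕ) : ℝ) * ε) ^ 2 ≤ S (m + k) ω ^ 2 := by
      rw [← sq_abs (S (m + k) ω)]
      exact pow_le_pow_left₀ (by positivity) hω 2
    have h5 : ε ^ 2 ≤ S (m + k) ω ^ 2 / ((m + k : ℕ) : ℝ) ^ 2 := by
      rw [le_div_iff₀ (by positivity)]
      nlinarith
    have : 0 ≤ v / ((m + k : ℕ) : ℝ) := by positivity
    simp only [hA]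
    linarith
  · intro k F hF
    have hF' := ℱ.le _ _ hF
    rw [← ofReal_integral_eq_lintegral_ofReal (hAint _).restrict (Eventually.of_forall (hA0 _)),
      ← ofReal_integral_eq_lintegral_ofReal (hAint _).restrict (Eventually.of_forall (hA0 _))]
    refine ENNReal.ofReal_le_ofReal ?_
    rw [hAF _ F hF', hAF _ F hF']
    have h1 := hstep (m + k) F hF
    have hk : (0 : ℝ) < ((m + k : ℕ) : ℝ) := by exact_mod_cast (by omega)
    have hI : 0 ≤ ∫ ω in F, S (m + k) ω ^ 2 ∂P := integral_nonneg fun ω => sq_nonneg _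
    have e : m + (k + 1) = (m + k) + 1 := rfl
    rw [e, Nat.cast_succ]
    generalize ((m + k : ℕ) : ℝ) = x at *
    generalize (∫ ω in F, S (m + k) ω ^ 2 ∂P) = I at *
    have hpv : 0 ≤ P.real F * v := by positivity
    have h2 : 1 / (x + 1) ^ 2 + 1 / (x + 1) ≤ 1 / x := by
      rw [div_add_div _ _ (by positivity) (by positivity), div_le_div_iff₀ (by positivity) hk]
      nlinarith [sq_nonneg x, pow_pos hk 3]
    calc _ ≤ (I + P.real F * v) / (x + 1) ^ 2 + P.real F * (v / (x + 1)) := by gcongr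
      _ = I / (x + 1) ^ 2 + P.real F * v * (1 / (x + 1) ^ 2 + 1 / (x + 1)) := by ring
      _ ≤ I / x ^ 2 + P.real F * v * (1 / x) := by gcongr; linarith
      _ = _ := by ring

/-! ### The self-normalised exponential supermartingale -/

/-- The derivative of `(1 + x + x ^ 2 / 3) * exp (x ^ 2 / 6 - x)` is `x ^ 3 / 9` times the
exponential, so this function is minimal at `0`, where it equals one. -/
lemma exp_sub_sq_div_six_le (x : ℝ) : Real.exp (x - x ^ 2 / 6) ≤ 1 + x + x ^ 2 / 3 := by
  set h : ℝ → ℝ := fun x => (1 + x + x ^ 2 / 3) * Real.exp (x ^ 2 / 6 - x) with hh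
  have hd : ∀ y, HasDerivAt h (y ^ 3 / 9 * Real.exp (y ^ 2 / 6 - y)) y := by
    intro y
    have h1 : HasDerivAt (fun x : ℝ => 1 + x + x ^ 2 / 3) (1 + 2 * y / 3) y := by
      refine (((hasDerivAt_id y).const_add 1).add ((hasDerivAt_pow 2 y).div_const 3)).congr_deriv ?_
      simp
    have h2 : HasDerivAt (fun x : ℝ => x ^ 2 / 6 - x) (2 * y / 6 - 1) y := by
      refine (((hasDerivAt_pow 2 y).div_const 6).sub (hasDerivAt_id y)).congr_deriv ?_
      simp
    exact (h1.mul h2.exp).congr_deriv (by ring)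
  have hcont : Continuous h := by fun_prop
  have h0 : h 0 = 1 := by simp [hh]
  have key : 1 ≤ h x := by
    rcases le_total 0 x with hx | hx
    · rw [← h0]
      refine monotoneOn_of_deriv_nonneg (convex_Ici 0) hcont.continuousOn
        (fun y _ => (hd y).differentiableAt.differentiableWithinAt) ?_ Set.self_mem_Ici hx hx
      intro y hy
      rw [interior_Ici] at hy
      rw [(hd y).deriv]
      have : 0 < y := hy
      positivity
    · rw [← h0]
      refine antitoneOn_of_deriv_nonpos (convex_Iic 0) hcont.continuousOn
        (fun y _ => (hd y).differentiableAt.differentiableWithinAt) ?_ hx Set.self_mem_Iic hx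
      intro y hy
      rw [interior_Iic] at hy
      rw [(hd y).deriv]
      have h3 : y ^ 3 ≤ 0 := Odd.pow_nonpos (by decide) (le_of_lt hy)
      exact mul_nonpos_of_nonpos_of_nonneg (by linarith) (Real.exp_pos _).le
  have e : Real.exp (x - x ^ 2 / 6) * Real.exp (x ^ 2 / 6 - x) = 1 := by
    rw [← Real.exp_add]; simp
  have := Real.exp_pos (x ^ 2 / 6 - x)
  simp only [hh] at key
  nlinarith

/-- The one-step bound that makes `exp (l * S - l ^ 2 * V / 2)` a supermartingale when the
variance proxy `V` mixes the observed and the expected squares with weights `1 / 3` and `2 / 3`. -/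
lemma lintegral_exp_le_one {Ω : Type*} {mΩ : MeasurableSpace Ω} {P : Measure Ω}
    [IsProbabilityMeasure P] {Y : Ω → ℝ} (hY : MemLp Y 2 P) (hmean : ∫ ω, Y ω ∂P = 0) (l : ℝ) :
    ∫⁻ ω, ENNReal.ofReal (Real.exp
      (l * Y ω - l ^ 2 * (Y ω ^ 2 / 3 + 2 * (∫ ω, Y ω ^ 2 ∂P) / 3) / 2)) ∂P ≤ 1 := by
  set v := ∫ ω, Y ω ^ 2 ∂P
  have hY1 : Integrable Y P := hY.integrable one_le_two
  have hY2 : Integrable (fun ω => Y ω ^ 2) P := hY.integrable_sq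
  have h1 : Integrable (fun ω => 1 + l * Y ω) P := (integrable_const 1).add (hY1.const_mul l)
  have h2 : Integrable (fun ω => 1 + l * Y ω + l ^ 2 / 3 * Y ω ^ 2) P :=
    h1.add (hY2.const_mul _)
  have hpt : ∀ ω, Real.exp (l * Y ω - l ^ 2 * (Y ω ^ 2 / 3 + 2 * v / 3) / 2)
      ≤ (1 + l * Y ω + l ^ 2 / 3 * Y ω ^ 2) * Real.exp (-(l ^ 2 / 3 * v)) := by
    intro ω
    rw [show l * Y ω - l ^ 2 * (Y ω ^ 2 / 3 + 2 * v / 3) / 2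
      = (l * Y ω - (l * Y ω) ^ 2 / 6) + -(l ^ 2 / 3 * v) by ring, Real.exp_add]
    gcongr
    refine (exp_sub_sq_div_six_le _).trans_eq ?_
    ring
  calc _ ≤ ∫⁻ ω, ENNReal.ofReal
        ((1 + l * Y ω + l ^ 2 / 3 * Y ω ^ 2) * Real.exp (-(l ^ 2 / 3 * v))) ∂P :=
        lintegral_mono fun ω => ENNReal.ofReal_le_ofReal (hpt ω)
    _ = ENNReal.ofReal ((1 + l ^ 2 / 3 * v) * Real.exp (-(l ^ 2 / 3 * v))) := by
        rw [← ofReal_integral_eq_lintegral_ofReal (h2.mul_const _)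
          (Eventually.of_forall fun ω => (Real.exp_pos _).le.trans (hpt ω)), integral_mul_const,
          integral_add h1 (hY2.const_mul _), integral_add (integrable_const 1) (hY1.const_mul l),
          integral_const_mul, integral_const_mul, hmean]
        simp [v]
    _ ≤ 1 := by
        rw [ENNReal.ofReal_le_one, Real.exp_neg, ← div_eq_mul_inv, div_le_one (Real.exp_pos _)]
        have := Real.add_one_le_exp (l ^ 2 / 3 * v)
        linarith

/-- Products of independent nonnegative factors of mean at most one satisfy the set-wise
supermartingale inequality. -/
lemma setLIntegral_prod_succ_le {Ω : Type*} {mΩ : MeasurableSpace Ω} {P : Measure Ω}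
    (ℱ : Filtration ℕ mΩ) {g : ℕ → Ω → ℝ≥0∞} {𝒢 : ℕ → MeasurableSpace Ω}
    (hmeas : ∀ i, Measurable[ℱ (i + 1)] (g i)) (h𝒢 : ∀ i, 𝒢 i ≤ mΩ)
    (hg : ∀ i, Measurable[𝒢 i] (g i)) (hind : ∀ i, Indep (ℱ i) (𝒢 i) P)
    (hint : ∀ i, ∫⁻ ω, g i ω ∂P ≤ 1) (k : ℕ) {F : Set Ω} (hF : MeasurableSet[ℱ k] F) :
    ∫⁻ ω in F, ∏ i ∈ Finset.range (k + 1), g i ω ∂P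
      ≤ ∫⁻ ω in F, ∏ i ∈ Finset.range k, g i ω ∂P := by
  have hF' := ℱ.le k _ hF
  have hprod : Measurable[ℱ k] (fun ω => ∏ i ∈ Finset.range k, g i ω) :=
    Finset.measurable_prod _ fun i hi => (hmeas i).mono (ℱ.mono (Finset.mem_range.1 hi)) le_rfl
  rw [← lintegral_indicator hF', ← lintegral_indicator hF']
  calc _ = ∫⁻ ω, F.indicator (fun ω => ∏ i ∈ Finset.range k, g i ω) ω * g k ω ∂P := by
        refine lintegral_congr fun ω => ?_
        by_cases h : ω ∈ F <;> simp [h, Finset.prod_range_succ]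
    _ = (∫⁻ ω, F.indicator (fun ω => ∏ i ∈ Finset.range k, g i ω) ω ∂P) * ∫⁻ ω, g k ω ∂P :=
        lintegral_mul_eq_lintegral_mul_lintegral_of_independent_measurableSpace (ℱ.le k) (h𝒢 k)
          (hind k) (hprod.indicator hF) (hg k)
    _ ≤ _ := mul_le_of_le_one_right (by simp) (hint k)

/-! ### The Gaussian mixture -/

/-- The mixture of `exp (l * s - l ^ 2 * u / 2)` over `l ∼ N(0, ρ)`, in closed form. -/
noncomputable def gaussianMixture (ρ s u : ℝ) : ℝ :=
  Real.exp (ρ * s ^ 2 / (2 * (ρ * u + 1))) / Real.sqrt (ρ * u + 1)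

lemma ofReal_gaussianMixture {ρ : ℝ} (hρ : 0 < ρ) (s : ℝ) {u : ℝ} (hu : 0 ≤ u) :
    ENNReal.ofReal (gaussianMixture ρ s u)
      = ∫⁻ l, ENNReal.ofReal (Real.exp (l * s - l ^ 2 * u / 2))
          ∂(gaussianReal 0 ρ.toNNReal) := by
  have hD : 0 < ρ * u + 1 := by positivity
  have hρ' : ρ.toNNReal ≠ 0 := by simpa using hρ
  have hw : (ρ / (ρ * u + 1)).toNNReal ≠ 0 := by simpa using div_pos hρ hD
  have hG0 : 0 ≤ gaussianMixture ρ s u := by unfold gaussianMixture; positivity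
  -- Completing the square turns the integrand into the density of
  -- `N(ρ * s / (ρ * u + 1), ρ / (ρ * u + 1))`, up to the factor `gaussianMixture ρ s u`.
  have hpt : ∀ l, gaussianPDF 0 ρ.toNNReal l * ENNReal.ofReal (Real.exp (l * s - l ^ 2 * u / 2))
      = ENNReal.ofReal (gaussianMixture ρ s u)
        * gaussianPDF (ρ * s / (ρ * u + 1)) (ρ / (ρ * u + 1)).toNNReal l := by
    intro l
    rw [gaussianPDF, gaussianPDF, ← ENNReal.ofReal_mul (gaussianPDFReal_nonneg _ _ _),
      ← ENNReal.ofReal_mul hG0]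
    congr 1
    rw [gaussianPDFReal, gaussianPDFReal, Real.coe_toNNReal _ hρ.le,
      Real.coe_toNNReal _ (div_pos hρ hD).le, gaussianMixture]
    have hs : Real.sqrt (2 * Real.pi * (ρ / (ρ * u + 1)))
        = Real.sqrt (2 * Real.pi * ρ) / Real.sqrt (ρ * u + 1) := by
      rw [← mul_div_assoc, Real.sqrt_div (by positivity)]
    rw [hs, mul_assoc, ← Real.exp_add]
    have h1 : Real.sqrt (ρ * u + 1) ≠ 0 := (Real.sqrt_pos.2 hD).ne'
    have h2 : Real.sqrt (2 * Real.pi * ρ) ≠ 0 :=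
      (Real.sqrt_pos.2 (by positivity)).ne'
    have h3 : -(l - 0) ^ 2 / (2 * ρ) + (l * s - l ^ 2 * u / 2)
        = ρ * s ^ 2 / (2 * (ρ * u + 1))
          + -(l - ρ * s / (ρ * u + 1)) ^ 2 / (2 * (ρ / (ρ * u + 1))) := by
      field_simp
      ring
    rw [h3, Real.exp_add]
    field_simp
  rw [gaussianReal_of_var_ne_zero _ hρ',
    lintegral_withDensity_eq_lintegral_mul _ (measurable_gaussianPDF _ _) (by fun_prop)]
  simp only [Pi.mul_apply, hpt]
  rw [lintegral_const_mul _ (measurable_gaussianPDF _ _), lintegral_gaussianPDF_eq_one _ hw,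
    mul_one]

lemma postHocLoss_le_inv_ofReal (K : ℝ → Set ℝ) {a : ℝ} (ϑ : ℝ) :
    postHocLoss K a ϑ ≤ (ENNReal.ofReal a)⁻¹ := by
  refine iSup₂_le fun α hα => ?_
  rw [← one_div]
  exact ENNReal.div_le_div (Set.indicator_le_self' (fun _ _ => by simp) _)
    (ENNReal.ofReal_le_ofReal hα.le)

/-- Inverting the interval: it misses `ϑ` only at levels `α` with `1 / α` at most the mixture. -/
lemma postHocLoss_mixtureInterval_le {Ω : Type*} (X : ℕ → Ω → ℝ) {ρ : ℝ} (hρ : 0 < ρ)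
    {m k : ℕ} (hk : 1 ≤ k) (ω : Ω) (hu : 0 ≤ uHat X m k ω) {a : ℝ} (ha : 0 ≤ a) (ϑ : ℝ) :
    postHocLoss (fun α => mixtureInterval X ρ m k α ω) a ϑ
      ≤ ENNReal.ofReal
          (gaussianMixture ρ (∑ i ∈ Finset.range k, (X i ω - ϑ)) (uHat X m k ω)) := by
  refine iSup₂_le fun α hα => ?_
  have hα0 : 0 < α := ha.trans_lt hα
  by_cases hmem : ϑ ∈ mixtureInterval X ρ m k α ω
  · simp [hmem]
  rw [Set.indicator_of_mem hmem, one_div, ← ENNReal.ofReal_inv_of_pos hα0]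
  refine ENNReal.ofReal_le_ofReal ?_
  set u := uHat X m k ω with hu'
  have hD : 0 < ρ * u + 1 := by positivity
  have hk0 : (0 : ℝ) < k := by exact_mod_cast hk
  set S := ∑ i ∈ Finset.range k, (X i ω - ϑ) with hS
  have hmeanS : sampleMean X k ω - ϑ = S / k := by
    rw [hS, Finset.sum_sub_distrib, sampleMean]
    simp only [Finset.sum_const, Finset.card_range, nsmul_eq_mul]
    field_simp
  have habs : mixtureHalfWidth X ρ m k α ω ≤ |sampleMean X k ω - ϑ| := by
    by_contra! h
    rw [abs_lt] at h
    exact hmem ⟨by linarith [h.2], by linarith [h.1]⟩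
  rw [mixtureHalfWidth, Real.sqrt_le_iff, sq_abs, hmeanS] at habs
  have hlog : Real.log (Real.sqrt (ρ * u + 1) / α) ≤ ρ * S ^ 2 / (2 * (ρ * u + 1)) := by
    have h := habs.2
    rw [← hu'] at h
    have hc : 0 < (2 * ρ * u + 2) / ((k : ℝ) ^ 2 * ρ) := by positivity
    rw [← le_div_iff₀' hc] at h
    refine h.trans_eq ?_
    field_simp
  have hsq := Real.sqrt_pos.2 hD
  rw [Real.log_le_iff_le_exp (by positivity), div_le_iff₀ hα0] at hlog
  rw [gaussianMixture, le_div_iff₀ hsq, inv_mul_le_iff₀ hα0]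
  linarith

lemma ofReal_gaussianMixture_anti {ρ : ℝ} (hρ : 0 < ρ) (s : ℝ) {v u : ℝ} (hv : 0 ≤ v)
    (hvu : v ≤ u) :
    ENNReal.ofReal (gaussianMixture ρ s u) ≤ ENNReal.ofReal (gaussianMixture ρ s v) := by
  rw [ofReal_gaussianMixture hρ s hv, ofReal_gaussianMixture hρ s (hv.trans hvu)]
  refine lintegral_mono fun l => ENNReal.ofReal_le_ofReal (Real.exp_le_exp.2 ?_)
  gcongr

/-! ### Independent observations -/

lemma measurable_comp_observationFiltration {Ω : Type*} {mΩ : MeasurableSpace Ω} {X : ℕ → Ω → ℝ}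
    (hX : ∀ i, Measurable (X i)) {β : Type*} [MeasurableSpace β] {h : ℝ → β} (hh : Measurable h)
    (i : ℕ) : Measurable[observationFiltration X hX (i + 1)] (fun ω => h (X i ω)) := by
  have : Measurable[observationFiltration X hX (i + 1)] (X i) :=
    Measurable.mono (comap_measurable (X i))
      (le_iSup₂_of_le (f := fun j (_ : j < i + 1) => MeasurableSpace.comap (X j) inferInstance)
        i i.lt_succ_self le_rfl) le_rfl
  exact hh.comp this

lemma indep_observationFiltration_comap {Ω : Type*} {mΩ : MeasurableSpace Ω} {P : Measure Ω}
    {X : ℕ → Ω → ℝ} (hX : ∀ i, Measurable (X i)) (hindep : iIndepFun X P) (i : ℕ) :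
    Indep (observationFiltration X hX i) (MeasurableSpace.comap (X i) inferInstance) P := by
  have := indep_iSup_of_disjoint (fun j => (hX j).comap_le) hindep
    (S := Set.Iio i) (T := {i}) (by simp)
  refine indep_of_indep_of_le_right this ?_
  exact le_iSup₂_of_le (f := fun j (_ : j ∈ ({i} : Set ℕ)) =>
    MeasurableSpace.comap (X j) inferInstance) i rfl le_rfl

lemma measure_exists_mul_le_abs_sum_comp_le {Ω : Type*} {mΩ : MeasurableSpace Ω} {P : Measure Ω}
    [IsProbabilityMeasure P] {X : ℕ → Ω → ℝ} (hX : ∀ i, Measurable (X i))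
    (hindep : iIndepFun X P) (hident : ∀ i, IdentDistrib (X i) (X 0) P P)
    {h : ℝ → ℝ} (hh : Measurable h) {v : ℝ} (hL2 : MemLp (fun ω => h (X 0 ω)) 2 P)
    (hmean : ∫ ω, h (X 0 ω) ∂P = 0) (hvar : ∫ ω, h (X 0 ω) ^ 2 ∂P ≤ v)
    {m : ℕ} (hm : 1 ≤ m) {ε : ℝ} (hε : 0 < ε) :
    P (⋃ k, {ω | ((m + k : ℕ) : ℝ) * ε ≤ |∑ i ∈ Finset.range (m + k), h (X i ω)|})
      ≤ ENNReal.ofReal (2 * v / (m * ε ^ 2)) := by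
  have hid : ∀ i, IdentDistrib (fun ω => h (X i ω)) (fun ω => h (X 0 ω)) P P := fun i =>
    (hident i).comp hh
  refine measure_exists_mul_le_abs_sum_le (observationFiltration X hX)
    (Z := fun i ω => h (X i ω)) (measurable_comp_observationFiltration hX hh) (fun i => ?_)
    (fun i => (hid i).memLp_iff.2 hL2) (fun i => (hid i).integral_eq.trans hmean) (fun i => ?_)
    hm hε
  · refine indep_of_indep_of_le_right (indep_observationFiltration_comap hX hindep i) ?_
    exact (hh.comp (comap_measurable (X i))).comap_le
  · exact ((hid i).comp (measurable_id.pow_const 2)).integral_eq.trans_le hvar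

/-- Stopping the Gaussian mixture of exponential supermartingales: its expectation at a stopping
time, here given by the events `E k` of stopping at `k`, is at most one. -/
lemma tsum_setLIntegral_gaussianMixture_le_one {Ω : Type*} {mΩ : MeasurableSpace Ω}
    {P : Measure Ω} [IsProbabilityMeasure P] {X : ℕ → Ω → ℝ} (hX : ∀ i, Measurable (X i))
    (hindep : iIndepFun X P) (hident : ∀ i, IdentDistrib (X i) (X 0) P P) {μ : ℝ}
    (hL2 : MemLp (fun ω => X 0 ω - μ) 2 P) (hmean : ∫ ω, (X 0 ω - μ) ∂P = 0)
    {ρ : ℝ} (hρ : 0 < ρ) {E : ℕ → Set Ω}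
    (hE : ∀ k, MeasurableSet[observationFiltration X hX k] (E k))
    (hdisj : Pairwise (Function.onFun Disjoint E)) :
    ∑' k, ∫⁻ ω in E k, ENNReal.ofReal (gaussianMixture ρ (∑ i ∈ Finset.range k, (X i ω - μ))
      (∑ i ∈ Finset.range k, ((X i ω - μ) ^ 2 / 3 + 2 * (∫ ω, (X 0 ω - μ) ^ 2 ∂P) / 3))) ∂P
      ≤ 1 := by
  set v := ∫ ω, (X 0 ω - μ) ^ 2 ∂P
  have hv : 0 ≤ v := integral_nonneg fun ω => sq_nonneg _
  let g : ℝ → ℝ → ℝ≥0∞ := fun l x => ENNReal.ofReal (Real.exp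
    (l * (x - μ) - l ^ 2 * ((x - μ) ^ 2 / 3 + 2 * v / 3) / 2))
  have hg : ∀ l, Measurable (g l) := fun l => by fun_prop
  have hprod : ∀ k l ω, ENNReal.ofReal (Real.exp (l * (∑ i ∈ Finset.range k, (X i ω - μ)) -
      l ^ 2 * (∑ i ∈ Finset.range k, ((X i ω - μ) ^ 2 / 3 + 2 * v / 3)) / 2))
      = ∏ i ∈ Finset.range k, g l (X i ω) := by
    intro k l ω
    rw [← ENNReal.ofReal_prod_of_nonneg fun _ _ => (Real.exp_pos _).le, ← Real.exp_sum,
      Finset.sum_sub_distrib (fun i => l * (X i ω - μ)), Finset.mul_sum, Finset.mul_sum,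
      Finset.sum_div]
  have hmix : ∀ k, ∫⁻ ω in E k,
      ENNReal.ofReal (gaussianMixture ρ (∑ i ∈ Finset.range k, (X i ω - μ))
        (∑ i ∈ Finset.range k, ((X i ω - μ) ^ 2 / 3 + 2 * v / 3))) ∂P
      = ∫⁻ l, ∫⁻ ω in E k, ∏ i ∈ Finset.range k, g l (X i ω) ∂P
          ∂(gaussianReal 0 ρ.toNNReal) := by
    intro k
    rw [lintegral_lintegral_swap]
    · refine lintegral_congr fun ω => ?_
      rw [ofReal_gaussianMixture hρ _ (Finset.sum_nonneg fun i _ => by positivity)]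
      simp only [hprod]
    · refine Measurable.aemeasurable ?_
      refine Finset.measurable_prod _ fun i _ => ?_
      have := hX i
      simp only [g]
      fun_prop
  have hgE : ∀ l i, ∫⁻ ω, g l (X i ω) ∂P ≤ 1 := by
    intro l i
    exact ((hident i).comp (hg l)).lintegral_eq.trans_le (lintegral_exp_le_one hL2 hmean l)
  simp only [hmix]
  rw [← lintegral_tsum]
  · calc _ ≤ ∫⁻ _, 1 ∂(gaussianReal 0 ρ.toNNReal) := by
          refine lintegral_mono fun l => ?_
          refine (tsum_setLIntegral_le_lintegral_zero
            (fun _ _ h => (observationFiltration X hX).mono h)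
            (observationFiltration X hX).le (fun k F hF => ?_) hE hdisj).trans ?_
          · refine setLIntegral_prod_succ_le (observationFiltration X hX)
              (g := fun i ω => g l (X i ω))
              (𝒢 := fun i => MeasurableSpace.comap (X i) inferInstance)
              (measurable_comp_observationFiltration hX (hg l)) (fun i => (hX i).comap_le)
              (fun i => (hg l).comp (comap_measurable (X i)))
              (indep_observationFiltration_comap hX hindep) (hgE l) k hF
          · simp
      _ = 1 := by simp
  · intro k
    refine Measurable.aemeasurable ?_
    refine Measurable.lintegral_prod_right ?_
    refine Finset.measurable_prod _ fun i _ => ?_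
    have := hX i
    simp only [g]
    fun_prop

/-! ### The empirical variance proxy -/

lemma uHat_eq {Ω : Type*} (X : ℕ → Ω → ℝ) (m : ℕ) {k : ℕ} (hk : 1 ≤ k) (ω : Ω) (μ : ℝ) :
    uHat X m k ω = ∑ i ∈ Finset.range k, (X i ω - μ) ^ 2
      - (∑ i ∈ Finset.range k, (X i ω - μ)) ^ 2 / k + k / Real.log m := by
  have hk0 : (k : ℝ) ≠ 0 := by exact_mod_cast (by omega)
  set S := ∑ i ∈ Finset.range k, (X i ω - μ) with hS
  have hmean : sampleMean X k ω = μ + S / k := by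
    rw [hS, Finset.sum_sub_distrib, sampleMean]
    simp only [Finset.sum_const, Finset.card_range, nsmul_eq_mul]
    field_simp
    ring
  have hsum : ∑ i ∈ Finset.range k, (X i ω - sampleMean X k ω) ^ 2
      = ∑ i ∈ Finset.range k, (X i ω - μ) ^ 2 - S ^ 2 / k := by
    have : ∀ i, (X i ω - sampleMean X k ω) ^ 2
        = (X i ω - μ) ^ 2 - 2 * (S / k) * (X i ω - μ) + (S / k) ^ 2 := by
      intro i
      rw [hmean]
      ring
    simp only [this]
    rw [Finset.sum_add_distrib, Finset.sum_sub_distrib, ← Finset.mul_sum, ← hS]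
    simp only [Finset.sum_const, Finset.card_range, nsmul_eq_mul]
    field_simp
    ring
  rw [uHat, sampleVar, hsum]
  field_simp

/-- If the running mean is small and the truncated squares do not fall far below their mean, then
`û` dominates the variance proxy of the exponential supermartingale. The three losses
`1 / 4`, `1 / 4 * 2 / 3` and `1 / 4 * 2 / 3` are paid by the regularisation `1 / log m`. -/
lemma variance_proxy_le_uHat {Ω : Type*} (X : ℕ → Ω → ℝ) {m k : ℕ} (hk : 1 ≤ k) (ω : Ω)
    {μ v w b : ℝ} (hlog : 0 < Real.log m) (hvw : v - w ≤ 1 / (4 * Real.log m))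
    (hS : |∑ i ∈ Finset.range k, (X i ω - μ)| ≤ k * Real.sqrt (1 / (4 * Real.log m)))
    (hW : |∑ i ∈ Finset.range k, (min ((X i ω - μ) ^ 2) b - w)| ≤ k * (1 / (4 * Real.log m))) :
    ∑ i ∈ Finset.range k, ((X i ω - μ) ^ 2 / 3 + 2 * v / 3) ≤ uHat X m k ω := by
  have hk0 : (0 : ℝ) < k := by exact_mod_cast hk
  rw [uHat_eq X m hk ω μ, Finset.sum_add_distrib, ← Finset.sum_div]
  have h1 : (∑ i ∈ Finset.range k, (X i ω - μ)) ^ 2 / k ≤ k * (1 / (4 * Real.log m)) := by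
    rw [div_le_iff₀ hk0, ← sq_abs]
    calc _ ≤ (k * Real.sqrt (1 / (4 * Real.log m))) ^ 2 := by gcongr
      _ = _ := by rw [mul_pow, Real.sq_sqrt (by positivity)]; ring
  have h2 : ∑ i ∈ Finset.range k, min ((X i ω - μ) ^ 2) b
      ≤ ∑ i ∈ Finset.range k, (X i ω - μ) ^ 2 := Finset.sum_le_sum fun i _ => min_le_left _ _
  rw [Finset.sum_sub_distrib, Finset.sum_const, Finset.card_range, nsmul_eq_mul] at hW
  have h3 := (abs_le.1 hW).1
  have h4 := mul_le_mul_of_nonneg_left hvw hk0.le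
  have h5 : (k : ℝ) / Real.log m = 4 * (k * (1 / (4 * Real.log m))) := by field_simp
  have h6 : 0 < (k : ℝ) * (1 / (4 * Real.log m)) := by positivity
  rw [Finset.sum_const, Finset.card_range, nsmul_eq_mul, h5]
  linarith

/-! ### A non-asymptotic risk bound -/

/-- Truncation at `1 / a` bounds the loss on the event where `û` fails to dominate the variance
proxy; off this event the loss is at most the stopped supermartingale. -/
lemma lintegral_postHocLoss_mixtureInterval_le {Ω : Type*} {mΩ : MeasurableSpace Ω}
    {P : Measure Ω} [IsProbabilityMeasure P] {X : ℕ → Ω → ℝ} (hX : ∀ i, Measurable (X i))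
    (hindep : iIndepFun X P) (hident : ∀ i, IdentDistrib (X i) (X 0) P P) {μ : ℝ}
    (hL2 : MemLp (fun ω => X 0 ω - μ) 2 P) (hmean : ∫ ω, (X 0 ω - μ) ∂P = 0)
    {ρ : ℝ} (hρ : 0 < ρ) {m : ℕ} (hm : 1 ≤ m) (hlog : 0 < Real.log m) {v b a : ℝ}
    (hv : ∫ ω, (X 0 ω - μ) ^ 2 ∂P ≤ v) (hb : 0 ≤ b) (ha : 0 < a)
    (hbias : ∫ ω, (X 0 ω - μ) ^ 2 ∂P - ∫ ω, min ((X 0 ω - μ) ^ 2) b ∂P ≤ 1 / (4 * Real.log m))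
    {τ : Ω → WithTop ℕ} (hτ : IsStoppingTime (observationFiltration X hX) τ) :
    ∫⁻ ω, {ω | τ ω ≠ ⊤}.indicator (fun ω => postHocLoss
      (fun α => mixtureInterval X ρ m (max ((τ ω).untopD 0) m) α ω) a μ) ω ∂P
      ≤ 1 + ENNReal.ofReal
        ((8 * v * Real.log m / m + 32 * b ^ 2 * Real.log m ^ 2 / m) / a) := by
  have hm0 : (0 : ℝ) < m := by exact_mod_cast hm
  set w := ∫ ω, min ((X 0 ω - μ) ^ 2) b ∂P with hw
  set σ2 := ∫ ω, (X 0 ω - μ) ^ 2 ∂P with hσ2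
  have hσ0 : 0 ≤ σ2 := integral_nonneg fun ω => sq_nonneg _
  set η := 1 / (4 * Real.log m) with hη
  have hη0 : 0 < η := by positivity
  set B1 := ⋃ k, {ω | ((m + k : ℕ) : ℝ) * Real.sqrt η
    ≤ |∑ i ∈ Finset.range (m + k), (X i ω - μ)|} with hB1
  set B2 := ⋃ k, {ω | ((m + k : ℕ) : ℝ) * η
    ≤ |∑ i ∈ Finset.range (m + k), (min ((X i ω - μ) ^ 2) b - w)|} with hB2
  have hB1m : MeasurableSet B1 := MeasurableSet.iUnion fun k => by
    refine measurableSet_le measurable_const ?_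
    fun_prop
  have hB2m : MeasurableSet B2 := MeasurableSet.iUnion fun k => by
    refine measurableSet_le measurable_const ?_
    fun_prop
  have hP1 : P B1 ≤ ENNReal.ofReal (8 * v * Real.log m / m) := by
    refine (measure_exists_mul_le_abs_sum_comp_le hX hindep hident (h := fun x => x - μ)
      (by fun_prop) hL2 hmean hv hm (Real.sqrt_pos.2 hη0)).trans_eq ?_
    rw [Real.sq_sqrt hη0.le, hη]
    congr 1
    field_simp
    ring
  have hP2 : P B2 ≤ ENNReal.ofReal (32 * b ^ 2 * Real.log m ^ 2 / m) := by
    have hmin : ∀ ω, 0 ≤ min ((X 0 ω - μ) ^ 2) b ∧ min ((X 0 ω - μ) ^ 2) b ≤ b := fun ω =>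
      ⟨le_min (sq_nonneg _) hb, min_le_right _ _⟩
    have hmeas : Measurable fun ω => min ((X 0 ω - μ) ^ 2) b := by
      have := hX 0
      fun_prop
    have hint : Integrable (fun ω => min ((X 0 ω - μ) ^ 2) b) P :=
      Integrable.of_bound hmeas.aestronglyMeasurable b (Eventually.of_forall fun ω => by
        rw [Real.norm_of_nonneg (hmin ω).1]; exact (hmin ω).2)
    have hw0 : 0 ≤ w := integral_nonneg fun ω => (hmin ω).1
    have hwb : w ≤ b := by
      have := integral_mono hint (integrable_const b) fun ω => (hmin ω).2
      simpa using this
    have habs : ∀ ω, |min ((X 0 ω - μ) ^ 2) b - w| ≤ b := fun ω => by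
      rw [abs_le]
      constructor <;> linarith [(hmin ω).1, (hmin ω).2]
    refine (measure_exists_mul_le_abs_sum_comp_le hX hindep hident
      (h := fun x => min ((x - μ) ^ 2) b - w) (v := b ^ 2) (by fun_prop) ?_ ?_ ?_ hm
      hη0).trans_eq ?_
    · exact MemLp.of_bound (hmeas.sub_const w).aestronglyMeasurable b
        (Eventually.of_forall habs)
    · rw [integral_sub hint (integrable_const w)]
      simp [hw]
    · have hsq : ∀ ω, (min ((X 0 ω - μ) ^ 2) b - w) ^ 2 ≤ b ^ 2 := fun ω => by
        rw [← sq_abs]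
        exact pow_le_pow_left₀ (abs_nonneg _) (habs ω) 2
      have := integral_mono_of_nonneg (μ := P) (Eventually.of_forall fun ω => sq_nonneg _)
        (integrable_const (b ^ 2)) (Eventually.of_forall hsq)
      simpa using this
    · rw [hη]
      congr 1
      field_simp
      ring
  let E : ℕ → Set Ω := fun k => {ω | τ ω ≠ ⊤ ∧ max ((τ ω).untopD 0) m = k}
  have hE : ∀ k, MeasurableSet[observationFiltration X hX k] (E k) := by
    intro k
    rcases lt_trichotomy k m with h | h | h
    · have : E k = ∅ := by
        ext ω
        simp only [E, Set.mem_ofPred_eq, Set.mem_empty_iff_false, iff_false]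
        omega
      rw [this]
      exact @MeasurableSet.empty _ (observationFiltration X hX k)
    · subst h
      have : E k = {ω | τ ω ≤ k} := by
        ext ω
        simp only [E, Set.mem_ofPred_eq]
        cases τ ω with
        | top => simp
        | coe t =>
          change (WithTop.some t ≠ ⊤ ∧ max t k = k) ↔ WithTop.some t ≤ WithTop.some k
          simp
      rw [this]
      exact hτ k
    · have : E k = {ω | τ ω = k} := by
        ext ω
        simp only [E, Set.mem_ofPred_eq]
        cases τ ω with
        | top => simp
        | coe t =>
          change (WithTop.some t ≠ ⊤ ∧ max t m = k) ↔ WithTop.some t = WithTop.some k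
          rw [WithTop.coe_eq_coe]
          exact ⟨fun h' => by omega, fun h' => ⟨WithTop.coe_ne_top, by omega⟩⟩
      rw [this]
      exact hτ.measurableSet_eq k
  have hdisj : Pairwise (Function.onFun Disjoint E) := fun i j hij =>
    Set.disjoint_left.2 fun ω hi hj => hij (hi.2.symm.trans hj.2)
  let N : ℕ → Ω → ℝ≥0∞ := fun k ω => ENNReal.ofReal
    (gaussianMixture ρ (∑ i ∈ Finset.range k, (X i ω - μ))
      (∑ i ∈ Finset.range k, ((X i ω - μ) ^ 2 / 3 + 2 * σ2 / 3)))
  have hN : ∀ k, Measurable (N k) := fun k => by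
    simp only [N, gaussianMixture]
    fun_prop
  have hEm : ∀ k, MeasurableSet (E k) := fun k => (observationFiltration X hX).le k _ (hE k)
  have hpt : ∀ ω, {ω | τ ω ≠ ⊤}.indicator (fun ω => postHocLoss
      (fun α => mixtureInterval X ρ m (max ((τ ω).untopD 0) m) α ω) a μ) ω
      ≤ ∑' k, (E k).indicator (N k) ω
        + (B1 ∪ B2).indicator (fun _ => (ENNReal.ofReal a)⁻¹) ω := by
    intro ω
    by_cases hfin : τ ω ≠ ⊤
    swap
    · rw [Set.indicator_of_notMem (by simpa using hfin)]
      exact zero_le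
    rw [Set.indicator_of_mem (by exact hfin)]
    by_cases hbad : ω ∈ B1 ∪ B2
    · rw [Set.indicator_of_mem hbad]
      exact (postHocLoss_le_inv_ofReal _ _).trans le_add_self
    set k := max ((τ ω).untopD 0) m with hk
    have hmk : m ≤ k := le_max_right _ _
    obtain ⟨j, hj⟩ := Nat.exists_eq_add_of_le hmk
    have hg1 : |∑ i ∈ Finset.range k, (X i ω - μ)| ≤ k * Real.sqrt η := by
      by_contra! h
      exact hbad (Or.inl (Set.mem_iUnion.2 ⟨j, by rw [← hj]; exact h.le⟩))
    have hg2 : |∑ i ∈ Finset.range k, (min ((X i ω - μ) ^ 2) b - w)| ≤ k * η := by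
      by_contra! h
      exact hbad (Or.inr (Set.mem_iUnion.2 ⟨j, by rw [← hj]; exact h.le⟩))
    have hle := variance_proxy_le_uHat X (hm.trans hmk) ω hlog hbias hg1 hg2
    have hV0 : 0 ≤ ∑ i ∈ Finset.range k, ((X i ω - μ) ^ 2 / 3 + 2 * σ2 / 3) :=
      Finset.sum_nonneg fun i _ => by positivity
    calc _ ≤ N k ω := (postHocLoss_mixtureInterval_le X hρ (hm.trans hmk) ω (hV0.trans hle)
            ha.le μ).trans (ofReal_gaussianMixture_anti hρ _ hV0 hle)
      _ = (E k).indicator (N k) ω := (Set.indicator_of_mem (by exact ⟨hfin, hk.symm⟩) _).symm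
      _ ≤ ∑' k, (E k).indicator (N k) ω := ENNReal.le_tsum k
      _ ≤ _ := le_self_add
  refine (lintegral_mono hpt).trans ?_
  rw [lintegral_add_right _ (measurable_const.indicator (hB1m.union hB2m)),
    lintegral_tsum fun k => ((hN k).indicator (hEm k)).aemeasurable,
    lintegral_indicator_const (hB1m.union hB2m)]
  simp only [lintegral_indicator (hEm _)]
  refine add_le_add (tsum_setLIntegral_gaussianMixture_le_one hX hindep hident hL2 hmean hρ hE
    hdisj) ?_
  rw [ENNReal.ofReal_div_of_pos ha, div_eq_mul_inv, mul_comm]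
  gcongr
  refine (measure_union_le _ _).trans ((add_le_add hP1 hP2).trans_eq ?_)
  have hv0 := hσ0.trans hv
  rw [ENNReal.ofReal_add (by positivity) (by positivity)]

/-! ### Uniformity over the class of distributions -/

lemma abs_sub_rpow_le {q : ℝ} (hq : 0 ≤ q) (x c : ℝ) :
    |x - c| ^ q ≤ 2 ^ q * (|x| ^ q + |c| ^ q) := by
  have h1 : |x - c| ≤ 2 * max |x| |c| := by
    have := abs_sub x c
    have := le_max_left |x| |c|
    have := le_max_right |x| |c|
    linarith
  have h2 : (max |x| |c|) ^ q ≤ |x| ^ q + |c| ^ q := by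
    rcases max_choice |x| |c| with h | h <;> rw [h]
    · exact le_add_of_nonneg_right (by positivity)
    · exact le_add_of_nonneg_left (by positivity)
  calc _ ≤ (2 * max |x| |c|) ^ q := by gcongr
    _ = 2 ^ q * (max |x| |c|) ^ q := Real.mul_rpow (by norm_num) (by positivity)
    _ ≤ _ := by gcongr

/-- A uniform moment bound about the origin gives a uniform moment bound about any point. -/
lemma UniformlyBoundedMoment.exists_integral_abs_sub_rpow_le {Ω : Type*} [MeasurableSpace Ω]
    {𝒬 : Set (ProbabilityMeasure Ω)} {Y : Ω → ℝ} {q : ℝ} (h : UniformlyBoundedMoment 𝒬 Y q)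
    (hY : Measurable Y) (hq : 0 ≤ q) (c : ℝ) :
    ∃ K : ℝ, 0 ≤ K ∧ ∀ P ∈ 𝒬, Integrable (fun ω => |Y ω - c| ^ q) (P : Measure Ω) ∧
      ∫ ω, |Y ω - c| ^ q ∂(P : Measure Ω) ≤ K := by
  set B := ⨆ P ∈ 𝒬, ∫⁻ ω, ENNReal.ofReal (|Y ω| ^ q) ∂(P : Measure Ω) with hB
  have hBtop : B ≠ ∞ := ne_of_lt h
  refine ⟨2 ^ q * (B.toReal + |c| ^ q), by positivity, fun P hP => ?_⟩
  have hmeas : Measurable fun ω => |Y ω| ^ q := by fun_prop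
  have hle : ∫⁻ ω, ENNReal.ofReal (|Y ω| ^ q) ∂(P : Measure Ω) ≤ B :=
    le_iSup₂_of_le P hP le_rfl
  have hint : Integrable (fun ω => |Y ω| ^ q) (P : Measure Ω) := by
    refine ⟨hmeas.aestronglyMeasurable, ?_⟩
    rw [hasFiniteIntegral_iff_ofReal (Eventually.of_forall fun ω => by positivity)]
    exact hle.trans_lt h
  have hI : ∫ ω, |Y ω| ^ q ∂(P : Measure Ω) ≤ B.toReal := by
    rw [integral_eq_lintegral_of_nonneg_ae (Eventually.of_forall fun ω => by positivity)
      hmeas.aestronglyMeasurable]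
    exact ENNReal.toReal_mono hBtop hle
  have hdom : Integrable (fun ω => 2 ^ q * (|Y ω| ^ q + |c| ^ q)) (P : Measure Ω) :=
    (hint.add (integrable_const _)).const_mul _
  have hint' : Integrable (fun ω => |Y ω - c| ^ q) (P : Measure Ω) := by
    refine hdom.mono' (by fun_prop) (Eventually.of_forall fun ω => ?_)
    rw [Real.norm_of_nonneg (by positivity)]
    exact abs_sub_rpow_le hq _ _
  refine ⟨hint', (integral_mono hint' hdom fun ω => abs_sub_rpow_le hq _ _).trans ?_⟩
  rw [integral_const_mul, integral_add hint (integrable_const _)]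
  simp only [integral_const, probReal_univ, one_smul]
  gcongr

lemma sq_le_one_add_abs_rpow {δ : ℝ} (hδ : 0 ≤ δ) (y : ℝ) : y ^ 2 ≤ 1 + |y| ^ (2 + δ) := by
  have h0 : 0 ≤ |y| ^ (2 + δ) := by positivity
  rw [← sq_abs]
  rcases le_total |y| 1 with h | h
  · have : |y| ^ 2 ≤ 1 := pow_le_one₀ (abs_nonneg y) h
    linarith
  · have : |y| ^ (2 : ℝ) ≤ |y| ^ (2 + δ) := Real.rpow_le_rpow_of_exponent_le h (by linarith)
    rw [Real.rpow_two] at this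
    linarith

lemma sq_sub_min_le {δ b : ℝ} (hδ : 0 ≤ δ) (hb : 0 < b) (y : ℝ) :
    y ^ 2 - min (y ^ 2) b ≤ |y| ^ (2 + δ) * b ^ (-(δ / 2)) := by
  rcases le_total (y ^ 2) b with h | h
  · rw [min_eq_left h, sub_self]
    positivity
  · rw [min_eq_right h]
    have hy : 0 < |y| := abs_pos.2 fun h0 => by subst h0; norm_num at h; linarith
    have h1 : b ^ (δ / 2) ≤ |y| ^ δ := by
      calc _ ≤ (y ^ 2) ^ (δ / 2) := by gcongr
        _ = |y| ^ δ := by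
          rw [← sq_abs, ← Real.rpow_two, ← Real.rpow_mul hy.le]
          congr 1
          ring
    have h2 : |y| ^ (2 + δ) * b ^ (-(δ / 2)) = y ^ 2 * (|y| ^ δ / b ^ (δ / 2)) := by
      rw [Real.rpow_add hy, Real.rpow_two, sq_abs, Real.rpow_neg hb.le]
      ring
    have h3 : 1 ≤ |y| ^ δ / b ^ (δ / 2) := (one_le_div (by positivity)).2 h1
    rw [h2]
    nlinarith [sq_nonneg y]

lemma tendsto_log_mul_rpow_neg {s : ℝ} (hs : 0 < s) :
    Tendsto (fun m : ℕ => Real.log m * (m : ℝ) ^ (-s)) atTop (nhds 0) := by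
  have h := (isLittleO_log_rpow_atTop hs).tendsto_div_nhds_zero.comp
    (tendsto_natCast_atTop_atTop (R := ℝ))
  refine h.congr fun m => ?_
  simp only [Function.comp_apply]
  rw [Real.rpow_neg (Nat.cast_nonneg m), div_eq_mul_inv]

/-- The exceptional probability for the truncation level `m ^ (1 / 8)` is of order
`m ^ (-3 / 4) * log m ^ 2`, which is negligible against `m ^ (-0.24)`. -/
lemma tendsto_exceptional_bound (v C : ℝ) :
    Tendsto (fun m : ℕ => (8 * v * Real.log m / m
      + 32 * ((m : ℝ) ^ (1 / 8 : ℝ)) ^ 2 * Real.log m ^ 2 / m) / (C * (m : ℝ) ^ (-0.24 : ℝ)))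
      atTop (nhds 0) := by
  have h1 := (tendsto_log_mul_rpow_neg (s := 0.76) (by norm_num)).const_mul (8 * v / C)
  have h2 := ((tendsto_log_mul_rpow_neg (s := 0.255) (by norm_num)).pow 2).const_mul (32 / C)
  have h := h1.add h2
  simp only [mul_zero, ne_eq, OfNat.ofNat_ne_zero, not_false_eq_true, zero_pow, add_zero] at h
  refine h.congr' ?_
  filter_upwards [eventually_ge_atTop 1] with m hm
  have hm0 : (0 : ℝ) < m := by exact_mod_cast hm
  have e1 : (m : ℝ) ^ (-0.76 : ℝ) = (m : ℝ)⁻¹ * ((m : ℝ) ^ (-0.24 : ℝ))⁻¹ := by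
    rw [← Real.rpow_neg_one, ← Real.rpow_neg hm0.le, ← Real.rpow_add hm0]
    norm_num
  have e2 : ((m : ℝ) ^ (-0.255 : ℝ)) ^ 2
      = ((m : ℝ) ^ (1 / 8 : ℝ)) ^ 2 * ((m : ℝ)⁻¹ * ((m : ℝ) ^ (-0.24 : ℝ))⁻¹) := by
    rw [← e1, ← Real.rpow_two, ← Real.rpow_two, ← Real.rpow_mul hm0.le, ← Real.rpow_mul hm0.le,
      ← Real.rpow_add hm0]
    norm_num
  rw [mul_pow, e2, e1]
  simp only [div_eq_mul_inv, mul_inv]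
  ring

lemma eventually_truncation_bias_le (K : ℝ) {δ : ℝ} (hδ : 0 < δ) :
    ∀ᶠ m : ℕ in atTop, K * ((m : ℝ) ^ (1 / 8 : ℝ)) ^ (-(δ / 2)) ≤ 1 / (4 * Real.log m) := by
  have h := (tendsto_log_mul_rpow_neg (s := δ / 16) (by positivity)).const_mul (4 * K)
  rw [mul_zero] at h
  filter_upwards [h.eventually (gt_mem_nhds one_pos), eventually_ge_atTop 2] with m hm hm2
  have hlog : 0 < Real.log m := Real.log_pos (by exact_mod_cast hm2)
  rw [← Real.rpow_mul (Nat.cast_nonneg m), le_div_iff₀ (by positivity)]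
  have e : (1 / 8 : ℝ) * (-(δ / 2)) = -(δ / 16) := by ring
  rw [e]
  linarith

theorem theorem6 {Ω : Type*} [MeasurableSpace Ω] (𝒬 : Set (ProbabilityMeasure Ω))
    (X : ℕ → Ω → ℝ) (hX : ∀ i, Measurable (X i))
    (hindep : ∀ P ∈ 𝒬, iIndepFun X (P : Measure Ω))
    (hident : ∀ P ∈ 𝒬, ∀ i, IdentDistrib (X i) (X 0) (P : Measure Ω) (P : Measure Ω))
    (δ μ : ℝ) (hδ : 0 < δ)
    (hclass : ∀ P ∈ 𝒬, (P : Measure Ω).map (X 0) ∈ momentClass (2 + δ) μ)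
    (hmoment : UniformlyBoundedMoment 𝒬 (X 0) (2 + δ))
    (C ρ : ℝ) (hC : 0 < C) (hρ : 0 < ρ) :
    IsAsympPostHocConfSeq (observationFiltration X hX) 𝒬 (fun _ => μ)
      (mixtureInterval X ρ) (fun m : ℕ => C * (m : ℝ) ^ (-0.24 : ℝ)) := by
  constructor
  · intro m hm n _ hmn
    have hm0 : (0 : ℝ) < m := by exact_mod_cast (Set.mem_Ici.1 hm)
    refine mul_le_mul_of_nonneg_left ?_ hC.le
    exact Real.rpow_le_rpow_of_nonpos hm0 (by exact_mod_cast hmn) (by norm_num)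
  · intro m hm
    have hm0 : (0 : ℝ) < m := by exact_mod_cast hm
    positivity
  · have h := ((tendsto_rpow_neg_atTop (y := 0.24) (by norm_num)).comp
      (tendsto_natCast_atTop_atTop (R := ℝ))).const_mul C
    rw [mul_zero] at h
    exact h.eventually (gt_mem_nhds one_pos)
  · intro τ hτ
    obtain ⟨K, hK, hKP⟩ := hmoment.exists_integral_abs_sub_rpow_le (hX 0)
      (by linarith : (0 : ℝ) ≤ 2 + δ) μ
    have hbound : ∀ᶠ m : ℕ in atTop, (⨆ P ∈ 𝒬, ∫⁻ ω, {ω | τ ω ≠ ⊤}.indicator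
        (fun ω => postHocLoss
          (fun α => mixtureInterval X ρ m (max ((τ ω).untopD 0) m) α ω)
          (C * (m : ℝ) ^ (-0.24 : ℝ)) μ) ω ∂(P : Measure Ω))
        ≤ 1 + ENNReal.ofReal ((8 * (1 + K) * Real.log m / m
          + 32 * ((m : ℝ) ^ (1 / 8 : ℝ)) ^ 2 * Real.log m ^ 2 / m)
            / (C * (m : ℝ) ^ (-0.24 : ℝ))) := by
      filter_upwards [eventually_truncation_bias_le K hδ, eventually_ge_atTop 2] with m hbias hm2
      have hm0 : (0 : ℝ) < m := by exact_mod_cast (by omega)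
      refine iSup₂_le fun P hP => ?_
      obtain ⟨-, hmapint, hmapmean, -⟩ := hclass P hP
      obtain ⟨hqint, hqle⟩ := hKP P hP
      have hXint : Integrable (X 0) (P : Measure Ω) :=
        (integrable_map_measure (by fun_prop) (hX 0).aemeasurable).1 hmapint
      have hmean : ∫ ω, (X 0 ω - μ) ∂(P : Measure Ω) = 0 := by
        rw [integral_map (hX 0).aemeasurable (by fun_prop)] at hmapmean
        rw [integral_sub hXint (integrable_const μ), hmapmean]
        simp
      have hdom : Integrable (fun ω => 1 + |X 0 ω - μ| ^ (2 + δ)) (P : Measure Ω) :=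
        (integrable_const 1).add hqint
      have hmeas : Measurable fun ω => X 0 ω - μ := (hX 0).sub_const μ
      have hsqint : Integrable (fun ω => (X 0 ω - μ) ^ 2) (P : Measure Ω) := by
        refine hdom.mono' (by fun_prop) (Eventually.of_forall fun ω => ?_)
        rw [Real.norm_of_nonneg (sq_nonneg _)]
        exact sq_le_one_add_abs_rpow hδ.le _
      have hvar : ∫ ω, (X 0 ω - μ) ^ 2 ∂(P : Measure Ω) ≤ 1 + K := by
        refine (integral_mono hsqint hdom fun ω => sq_le_one_add_abs_rpow hδ.le _).trans ?_
        rw [integral_add (integrable_const 1) hqint]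
        simpa using hqle
      have hb : 0 < (m : ℝ) ^ (1 / 8 : ℝ) := by positivity
      have hminint : Integrable (fun ω => min ((X 0 ω - μ) ^ 2) ((m : ℝ) ^ (1 / 8 : ℝ)))
          (P : Measure Ω) := hsqint.inf (integrable_const _)
      refine lintegral_postHocLoss_mixtureInterval_le hX (hindep P hP) (hident P hP)
        ((memLp_two_iff_integrable_sq hmeas.aestronglyMeasurable).2 hsqint) hmean hρ (by omega)
        (Real.log_pos (by exact_mod_cast hm2)) hvar hb.le (by positivity) ?_ hτ
      rw [← integral_sub hsqint hminint]
      refine (integral_mono (hsqint.sub hminint) (hqint.mul_const _)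
        fun ω => sq_sub_min_le hδ.le hb _).trans ?_
      rw [integral_mul_const]
      exact (by gcongr : _ ≤ K * _).trans hbias
    have hlim := (ENNReal.tendsto_ofReal (tendsto_exceptional_bound (1 + K) C)).const_add 1
    rw [ENNReal.ofReal_zero, add_zero] at hlim
    exact (limsup_le_limsup hbound).trans_eq hlim.limsup_eq
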